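/- Let $1\le k<n$ be integers and $s\in(1/2,1)$. Write $x=(y,z)\in\mathbb{R}^k\times\mathbb{R}^{n-k}=\mathbb{R}^n$, let $|\cdot|$ also denote Lebesgue measure, and let $\omega_k$ be the volume of the unit ball of $\mathbb{R}^k$. Let $c_{n,s}=\frac{4^s\,\Gamma(n/2+s)}{\pi^{n/2}|\Gamma(-s)|}$ and $$\Delta^s v(x_0)=c_{n,s}\,\mathrm{PV}\!\int_{\mathbb{R}^n}\frac{v(x_0+x)-v(x_0)}{|x|^{n+2s}}\,dx=c_{n,s}\lim_{\varepsilon\to0^+}\int_{|x|>\varepsilon}\frac{v(x_0+x)-v(x_0)}{|x|^{n+2s}}\,dx .$$ Let $\mathcal{K}_k^s$ be the set of measurable $K:\mathbb{R}^n\to[0,\infty)$ such that for all $z\in\mathbb{R}^{n-k}$ and $r>0$ the set $\{y\in\mathbb{R}^k:K(y,z)>r^{-n-2s}\}$ has $k$-dimensional measure $\omega_k(r^2-|z|^2)^{k/2}$ if $|z|<r$, and $0$ if $|z|\ge r$. Let $u:\mathbb{R}^n\to\mathbb{R}$ be continuous and let $x_0\in\mathbb{R}^n$. Suppose that $u\in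 C^{1,1}(x_0)$, that is, there are $p\in\mathbb{R}^n$, $\rho>0$ and $C>0$ with $|u(x_0+x)-u(x_0)-x\cdot p|\le C|x|^2$ for $|x|<\rho$ (so $p=\nabla u(x_0)$). Put $\tilde u(x)=u(x_0+x)-u(x_0)-x\cdot\nabla u(x_0)$ and $$\mathcal{F}_k^su(x_0)=c_{n,s}\inf_{K\in\mathcal{K}_k^s}\int_{\mathbb{R}^n}\tilde u(x)K(x)\,dx .$$ Suppose that 1. $\int_{\mathbb{R}^n}|u(x)|(1+|x|)^{-n-2s}\,dx<\infty$; 2. $\tilde u(x)\ge0$ for all $x\in\mathbb{R}^n$; 3. $|\{y\in\mathbb{R}^k:\tilde u(y,z)\le\lambda\}|<\infty$ for all $\lambda>0$ and all $z\in\mathbb{R}^{n-k}$. Let $\tilde u_{*,k}$ be the $k$-symmetric increasing rearrangement of $\tilde u$ in the first $k$ variables, $$\tilde u_{*,k}(y,z)=\inf\{\lambda>0:|\{w\in\mathbb{R}^k:\tilde u(w,z)\le\lambda\}|>\omega_k|y|^k\}\in[0,\infty],\qquad \inf\emptyset=\infty .$$ Then $\tilde u_{*,k}$ is finite everywhere,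 $\Delta^s\tilde u_{*,k}(0)$ exists as a finite principal value, with absolutely convergent truncated integrals, and $$\mathcal{F}_k^su(x_0)=\Delta^s\tilde u_{*,k}(0).$$ -/

import Mathlib

open MeasureTheory Filter Topology
open scoped ENNReal NNReal

noncomputable section

namespace FracMA

/-- The Euclidean space `ℝ^d`, with its Euclidean norm and Lebesgue measure
(on `ℝ^k` this is also the `k`-dimensional Hausdorff measure in its usual normalization). -/
abbrev E (d : ℕ) : Type := EuclideanSpace ℝ (Fin d)

/-- The point `(y, z)` of `ℝ^n`, `n = k + m`, with `y ∈ ℝ^k` and `z ∈ ℝ^m = ℝ^(n-k)`. -/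
def pt {k m : ℕ} (y : E k) (z : E m) : E (k + m) :=
  WithLp.toLp 2 (Fin.append (fun i => y i) (fun j => z j))

/-- The first `k` coordinates `y` of `x = (y, z)`. -/
def yPart {k m : ℕ} (x : E (k + m)) : E k :=
  WithLp.toLp 2 (fun i => x (Fin.castAdd m i))

/-- The last `m` coordinates `z` of `x = (y, z)`. -/
def zPart {k m : ℕ} (x : E (k + m)) : E m :=
  WithLp.toLp 2 (fun j => x (Fin.natAdd k j))

/-- The volume `ω_k` of the unit ball of `ℝ^k`. -/
def omega (k : ℕ) : ℝ := (volume (Metric.ball (0 : E k) 1)).toReal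

/-- The usual normalizing constant
`c_{d,s} = 4^s Γ(d/2 + s) / (π^(d/2) |Γ(-s)|)` of the fractional Laplacian on `ℝ^d`. -/
def fracConst (d : ℕ) (s : ℝ) : ℝ :=
  (4 : ℝ) ^ s * Real.Gamma ((d : ℝ) / 2 + s) /
    (Real.pi ^ ((d : ℝ) / 2) * |Real.Gamma (-s)|)

/-- `Δ^s v (x₀)` exists and equals `L`: the truncated integrals converge absolutely, and
`c_{d,s} ∫_{|x| > ε} (v (x₀ + x) - v x₀) |x|^(-d-2s) dx → L` as `ε → 0⁺`
(the principal value). -/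
def HasFracLaplacianAt {d : ℕ} (s : ℝ) (v : E d → ℝ) (x₀ : E d) (L : ℝ) : Prop :=
  (∀ ε : ℝ, 0 < ε →
    IntegrableOn (fun x : E d => (v (x₀ + x) - v x₀) * (1 / ‖x‖ ^ ((d : ℝ) + 2 * s)))
      {x : E d | ε < ‖x‖} volume) ∧
  Tendsto (fun ε : ℝ => fracConst d s *
      ∫ x in {x : E d | ε < ‖x‖}, (v (x₀ + x) - v x₀) * (1 / ‖x‖ ^ ((d : ℝ) + 2 * s)))
    (𝓝[>] 0) (𝓝 L)

/-- The class of admissible kernels on `ℝ^n`, `n = k + m`: Lebesgue measurable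
`K : ℝ^n → [0,∞)` such that, for all `z` and all `r > 0`, the `k`-dimensional measure of
`{y | K(y,z) > r^(-n-2s)}` is that of the ball of radius `(r² - |z|²)^(1/2)` in `ℝ^k` when
`|z| < r`, and `0` when `|z| ≥ r`. -/
def Kernels (k m : ℕ) (s : ℝ) : Set (E (k + m) → ℝ≥0) :=
  {K | AEMeasurable K volume ∧
    ∀ (z : E m) (r : ℝ), 0 < r →
      volume {y : E k | r ^ (-((k + m : ℕ) : ℝ) - 2 * s) < (K (pt y z) : ℝ)} =
        if ‖z‖ < r then volume (Metric.ball (0 : E k) (Real.sqrt (r ^ 2 - ‖z‖ ^ 2))) else 0}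

/-- `u ∈ C^{1,1}(x₀)`: a first order expansion with quadratic error near `x₀`. -/
def IsC11At {d : ℕ} (u : E d → ℝ) (x₀ : E d) : Prop :=
  ∃ p : E d, ∃ ρ : ℝ, 0 < ρ ∧ ∃ C : ℝ, 0 < C ∧
    ∀ x ∈ Metric.ball (0 : E d) ρ, |u (x₀ + x) - u x₀ - inner ℝ x p| ≤ C * ‖x‖ ^ 2

/-- `ũ(x) = u(x₀ + x) - u(x₀) - x · ∇u(x₀)`. -/
def tilde {d : ℕ} (u : E d → ℝ) (x₀ : E d) (x : E d) : ℝ :=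
  u (x₀ + x) - u x₀ - inner ℝ x (gradient u x₀)

/-- The integral `∫ f⁺ - ∫ f⁻` as an extended real number (with `∞ - ∞ = -∞`). -/
def extIntegral {d : ℕ} (f : E d → ℝ) : EReal :=
  ((∫⁻ x, ENNReal.ofReal (f x) : ℝ≥0∞) : EReal) -
    ((∫⁻ x, ENNReal.ofReal (-f x) : ℝ≥0∞) : EReal)

/-- `F_k^s u (x₀) = c_{n,s} inf_K ∫ ũ(x) K(x) dx`, the infimum over the admissible kernels,
as an extended real number. -/
def Fop (k m : ℕ) (s : ℝ) (u : E (k + m) → ℝ) (x₀ : E (k + m)) : EReal :=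
  (fracConst (k + m) s : EReal) *
    ⨅ K ∈ Kernels k m s, extIntegral (fun x => tilde u x₀ x * (K x : ℝ))

/-- The increasing rearrangement
`f_*(t) = inf {l > 0 : |{w : f w ≤ l}| > t}`, `t ≥ 0`, with `inf ∅ = ∞`. -/
def incRearrangement {d : ℕ} (f : E d → ℝ) (t : ℝ) : ℝ≥0∞ :=
  ⨅ (l : ℝ) (_ : 0 < l) (_ : ENNReal.ofReal t < volume {w : E d | f w ≤ l}), ENNReal.ofReal l

/-- The `k`-symmetric increasing rearrangement `f_{*,k}(y,z) = (f(·,z))_*(ω_k |y|^k)`. -/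
def kIncRearrangement (k m : ℕ) (f : E (k + m) → ℝ) (x : E (k + m)) : ℝ≥0∞ :=
  incRearrangement (fun w : E k => f (pt w (zPart x)))
    (omega k * ‖(yPart x : E k)‖ ^ k)

end FracMA

end

/-! Since `tilde u x₀` is nonnegative, Fubini reduces its pairing with a kernel `K` to the slices of
fixed `z`. Let `f` be such a slice, `f_*` its increasing rearrangement and `p = n + 2s`.
Admissibility says that `K(·,z)` has superlevel sets of the same measures as the radial function
`(|y|² + |z|²)^(-p/2)`.

Lower bound: by the layer cake formula only `|{f > l} ∩ {K > t}|` matters, and it is at least `|{K >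
t}| - |{f ≤ l}|`. For `f_*` and the radial function the intersection lies in a difference of
concentric balls, whose measure is at most the positive part of that number
(`lintegral_incRearrangement_mul_le`).

Attainment: order each slice by the value of `f`, ties broken by `|y|`. Spheres are null, so this
order has initial segments of every finite measure (`exists_segment`), and the radius of the ball
whose volume is the rank is equimeasurable with `|y|`, plateaus of `f` included (`map_rankRadius`).
Putting this radius in place of `|y|` in the radial function gives an admissible kernel, and `f ≤
f_*` at the rank (`le_incRearrangement_rank`) gives the reverse inequality.

Finiteness: `|x|^(-p)` is itself admissible and its pairing with `tilde u x₀` converges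
(`integrable_tilde_mul`). The rearrangement vanishes at the origin, so its principal value is an
absolutely convergent integral. -/

noncomputable section

namespace FracMA

open Set Metric

/-! ### Initial segments of prescribed measure -/

section Segments

variable {X : Type*} [MeasurableSpace X] {μ : Measure X} {g : X → ℝ}

/-- The quantile of level `a` of the distribution of a nonnegative function. -/
lemma exists_quantile (hg : Measurable g) (hg0 : ∀ x, 0 ≤ g x)
    (hfin : ∀ l, 0 < l → μ {x | g x ≤ l} < ∞) {a : ℝ≥0∞}
    (ha : ∃ l, 0 ≤ l ∧ a ≤ μ {x | g x ≤ l}) :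
    ∃ l, 0 ≤ l ∧ μ {x | g x < l} ≤ a ∧ a ≤ μ {x | g x ≤ l} := by
  set A : Set ℝ := {l | 0 ≤ l ∧ a ≤ μ {x | g x ≤ l}} with hA
  have hne : A.Nonempty := ha
  have hbdd : BddBelow A := ⟨0, fun l hl => hl.1⟩
  have h0 : 0 ≤ sInf A := le_csInf hne fun l hl => hl.1
  obtain ⟨v, hva', hv, hvlim⟩ := exists_seq_strictAnti_tendsto (0 : ℝ)
  have hva : Antitone v := hva'.antitone
  refine ⟨sInf A, h0, ?_, ?_⟩
  · have hU : {x | g x < sInf A} = ⋃ n, {x | g x ≤ sInf A - v n} := by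
      ext x
      simp only [mem_ofPred_eq, mem_iUnion]
      refine ⟨fun hx => ?_, fun ⟨n, hn⟩ => hn.trans_lt (sub_lt_self _ (hv n))⟩
      obtain ⟨n, hn⟩ := (hvlim.eventually_lt_const (sub_pos.2 hx)).exists
      exact ⟨n, by linarith⟩
    have hmono : Monotone fun n => {x | g x ≤ sInf A - v n} := fun i j hij x hx =>
      le_trans hx (sub_le_sub_left (hva hij) _)
    rw [hU, hmono.measure_iUnion]
    refine iSup_le fun n => ?_
    by_contra! hn
    -- A negative level is not in `A`, but its sublevel set is empty.
    by_cases hneg : 0 ≤ sInf A - v n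
    · have := csInf_le hbdd (show sInf A - v n ∈ A from ⟨hneg, hn.le⟩)
      linarith [hv n]
    · have : {x | g x ≤ sInf A - v n} = ∅ := by
        ext x
        simp only [mem_ofPred_eq, mem_empty_iff_false, iff_false, not_le]
        linarith [hg0 x]
      rw [this] at hn
      simp at hn
  · have hI : {x | g x ≤ sInf A} = ⋂ n, {x | g x ≤ sInf A + v n} := by
      ext x
      simp only [mem_ofPred_eq, mem_iInter]
      refine ⟨fun hx n => by linarith [hv n], fun h => ?_⟩
      refine le_of_tendsto_of_tendsto' tendsto_const_nhds (by simpa using hvlim.const_add (sInf A)) h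
    have hlim := tendsto_measure_iInter_atTop (μ := μ)
      (s := fun n => {x | g x ≤ sInf A + v n})
      (fun n => (measurableSet_le hg measurable_const).nullMeasurableSet)
      (fun i j hij x hx => le_trans hx (add_le_add_right (hva hij) _))
      ⟨0, (hfin _ (by linarith [hv 0])).ne⟩
    rw [hI]
    refine ge_of_tendsto' hlim fun n => ?_
    obtain ⟨l, hl, hlt⟩ := exists_lt_of_csInf_lt hne (lt_add_of_pos_right (sInf A) (hv n))
    exact hl.2.trans (measure_mono fun x hx => le_trans hx hlt.le)

lemma exists_measure_sublevel_gt {a : ℝ≥0∞} (ha : a < μ univ) :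
    ∃ l, 0 ≤ l ∧ a < μ {x | g x ≤ l} := by
  have hU : (univ : Set X) = ⋃ n : ℕ, {x | g x ≤ n} := by
    ext x
    simpa using exists_nat_ge (g x)
  have hmono : Monotone fun n : ℕ => {x | g x ≤ n} := fun i j hij x (hx : g x ≤ i) =>
    hx.trans (Nat.cast_le.2 hij : (i : ℝ) ≤ j)
  rw [hU, hmono.measure_iUnion] at ha
  obtain ⟨n, hn⟩ := lt_iSup_iff.1 ha
  exact ⟨n, n.cast_nonneg, hn⟩

end Segments

/-! ### Balls -/

lemma omega_pos (k : ℕ) : 0 < omega k :=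
  ENNReal.toReal_pos (measure_ball_pos _ _ one_pos).ne' measure_ball_lt_top.ne

lemma volume_ball_eq {k : ℕ} (hk : 1 ≤ k) {r : ℝ} (hr : 0 ≤ r) :
    volume (ball (0 : E k) r) = ENNReal.ofReal (omega k * r ^ k) := by
  have : Nonempty (Fin k) := ⟨⟨0, hk⟩⟩
  rw [Measure.addHaar_ball _ _ hr, finrank_euclideanSpace_fin, omega, mul_comm,
    ENNReal.ofReal_mul ENNReal.toReal_nonneg, ENNReal.ofReal_toReal measure_ball_lt_top.ne]

/-- The radius of the ball of `ℝ^k` of volume `t`. -/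
def ballRadius (k : ℕ) (t : ℝ) : ℝ := (t / omega k) ^ ((k : ℝ)⁻¹)

lemma ballRadius_nonneg (k : ℕ) {t : ℝ} (ht : 0 ≤ t) : 0 ≤ ballRadius k t :=
  Real.rpow_nonneg (div_nonneg ht (omega_pos k).le) _

lemma omega_mul_ballRadius_pow {k : ℕ} (hk : 1 ≤ k) {t : ℝ} (ht : 0 ≤ t) :
    omega k * ballRadius k t ^ k = t := by
  rw [ballRadius, Real.rpow_inv_natCast_pow (div_nonneg ht (omega_pos k).le) (by omega),
    mul_div_cancel₀ _ (omega_pos k).ne']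

lemma ballRadius_lt_iff {k : ℕ} (hk : 1 ≤ k) {t R : ℝ} (ht : 0 ≤ t) (hR : 0 ≤ R) :
    ballRadius k t < R ↔ t < omega k * R ^ k := by
  conv_rhs => rw [← omega_mul_ballRadius_pow hk ht]
  rw [mul_lt_mul_iff_right₀ (omega_pos k),
    pow_lt_pow_iff_left₀ (ballRadius_nonneg k ht) hR (by omega)]

/-! ### The rank of a point -/

section Rank

variable {k : ℕ} {f : E k → ℝ}

/-- The points strictly preceding `y`: those with a smaller value of `f`, ties being broken by
the norm. -/
def precSet (f : E k → ℝ) (y : E k) : Set (E k) := {w | f w < f y ∨ (f w = f y ∧ ‖w‖ < ‖y‖)}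

/-- The volume of the set of points strictly preceding `y`. -/
def rank (f : E k → ℝ) (y : E k) : ℝ≥0∞ := volume (precSet f y)

lemma rank_lt_top (hfin : ∀ l, 0 < l → volume {w | f w ≤ l} < ∞) (y : E k) : rank f y < ∞ := by
  refine lt_of_le_of_lt (measure_mono fun w hw => ?_) (hfin (max (f y) 1) (by positivity))
  rcases hw with h | h
  · exact h.le.trans (le_max_left _ _)
  · exact h.1.le.trans (le_max_left _ _)

lemma volume_univ_eq_top (hk : 1 ≤ k) : volume (univ : Set (E k)) = ∞ := by
  have : Nonempty (Fin k) := ⟨⟨0, hk⟩⟩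
  exact measure_univ_of_isAddLeftInvariant _

/-- Every finite measure is the measure of an initial segment of the order that defines `rank`. -/
lemma exists_segment (hk : 1 ≤ k) (hf : Measurable f) (hf0 : ∀ y, 0 ≤ f y)
    (hfin : ∀ l, 0 < l → volume {w | f w ≤ l} < ∞) {a : ℝ≥0∞} (ha : a < ∞) :
    ∃ S : Set (E k), volume S = a ∧ (∀ y ∈ S, precSet f y ⊆ S) ∧ ∀ y ∉ S, S ⊆ precSet f y := by
  have : Nonempty (Fin k) := ⟨⟨0, hk⟩⟩
  obtain ⟨l₁, hl₁, hl₁'⟩ := exists_measure_sublevel_gt (g := f)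
    (ha.trans_eq (volume_univ_eq_top hk).symm)
  obtain ⟨l, -, hlt, hle⟩ := exists_quantile hf hf0 hfin ⟨l₁, hl₁, hl₁'.le⟩
  -- Either the sublevel set has exactly the measure `a`, or `{f = l}` is a plateau of positive
  -- measure, of which only the part in a suitable centred ball is kept.
  rcases hle.eq_or_lt with heq | hgt
  · refine ⟨{w | f w ≤ l}, heq.symm, fun y hy w hw => ?_, fun y hy w hw => ?_⟩
    · simp only [precSet, mem_ofPred_eq] at *
      rcases hw with h | h <;> linarith
    · simp only [precSet, mem_ofPred_eq, not_le] at *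
      exact Or.inl (hw.trans_lt hy)
  set P : Set (E k) := {w | f w = l} with hP
  set D : Set (E k) := {w | f w < l} with hD
  have hPm : MeasurableSet P := measurableSet_eq_fun hf measurable_const
  have hdisj : Disjoint D P := by
    rw [Set.disjoint_left]
    intro w h1 h2
    exact (ne_of_lt h1) h2
  have hDP : {w | f w ≤ l} = D ∪ P := by
    ext w
    simp [hP, hD, le_iff_lt_or_eq]
  have hDfin : volume D ≠ ∞ := (hlt.trans_lt ha).ne
  have hPu : a - volume D < volume.restrict P univ := by
    rw [Measure.restrict_apply_univ]
    rw [hDP, measure_union hdisj hPm] at hgt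
    exact ENNReal.sub_lt_of_lt_add hlt (by rwa [add_comm])
  obtain ⟨r₁, hr₁, hr₁'⟩ := exists_measure_sublevel_gt (g := fun w : E k => ‖w‖) hPu
  obtain ⟨r, -, hrlt, hrle⟩ := exists_quantile (μ := volume.restrict P)
    (g := fun w : E k => ‖w‖) measurable_norm (fun w => norm_nonneg w)
    (fun r _ => (Measure.restrict_apply_le P _).trans_lt (by
      simpa [closedBall, dist_zero_right] using
        (measure_closedBall_lt_top (μ := volume) (x := (0 : E k)) (r := r))))
    ⟨r₁, hr₁, hr₁'.le⟩
  -- Null spheres turn the two quantile inequalities for the norm into an equality.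
  have hsphere : volume.restrict P {w : E k | ‖w‖ = r} = 0 := by
    refine le_antisymm ((Measure.restrict_apply_le P _).trans ?_) zero_le
    have := Measure.addHaar_sphere (volume : Measure (E k)) 0 r
    simpa [sphere, dist_zero_right] using this.le
  have hr : volume.restrict P {w : E k | ‖w‖ < r} = a - volume D := by
    refine le_antisymm hrlt (hrle.trans ?_)
    have : {w : E k | ‖w‖ ≤ r} = {w : E k | ‖w‖ < r} ∪ {w : E k | ‖w‖ = r} := by
      ext w
      simp [le_iff_lt_or_eq]
    rw [this]
    refine (measure_union_le _ _).trans ?_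
    rw [hsphere, add_zero]
  have hballm : MeasurableSet {w : E k | ‖w‖ < r} := measurableSet_lt measurable_norm measurable_const
  rw [Measure.restrict_apply hballm] at hr
  refine ⟨D ∪ ({w : E k | ‖w‖ < r} ∩ P), ?_, fun y hy w hw => ?_, fun y hy w hw => ?_⟩
  · rw [measure_union (hdisj.mono_right inter_subset_right) (hballm.inter hPm), hr]
    exact add_tsub_cancel_of_le hlt
  · simp only [precSet, mem_ofPred_eq, mem_union, mem_inter_iff, hD, hP] at *
    rcases hw with h | ⟨h, h'⟩ <;> rcases hy with g | ⟨g, g'⟩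
    · left; linarith
    · left; linarith
    · left; linarith
    · right; exact ⟨h'.trans g, h.trans g'⟩
  · simp only [precSet, mem_ofPred_eq, mem_union, mem_inter_iff, hD, hP, not_or, not_lt,
      not_and] at *
    rcases hw with h | ⟨h, h'⟩
    · left; linarith
    · rcases hy.1.eq_or_lt with e | e
      · right
        refine ⟨h'.trans e, ?_⟩
        by_contra! hc
        exact hy.2 (hc.trans_lt h) e.symm
      · left; linarith

/-- Points outside an initial segment of measure `a` have rank at least `a`, which gives `≤`. Points
inside have rank at most the measure of the segment, so the strict inequality needs segments of
measure `c < a`. -/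
lemma volume_rank_lt (hk : 1 ≤ k) (hf : Measurable f) (hf0 : ∀ y, 0 ≤ f y)
    (hfin : ∀ l, 0 < l → volume {w | f w ≤ l} < ∞) {a : ℝ≥0∞} (ha : a < ∞) :
    volume {y | rank f y < a} = a := by
  apply le_antisymm
  · obtain ⟨S, hS, -, hS2⟩ := exists_segment hk hf hf0 hfin ha
    rw [← hS]
    refine measure_mono fun y hy => ?_
    by_contra hyS
    exact absurd (measure_mono (μ := volume) (hS2 y hyS)) (not_le.2 hy)
  · refine le_of_forall_lt fun b hb => ?_
    obtain ⟨c, hbc, hca⟩ := exists_between hb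
    obtain ⟨S, hS, hS1, -⟩ := exists_segment hk hf hf0 hfin (hca.trans ha)
    refine hbc.trans_le (hS ▸ measure_mono fun y hy => ?_)
    exact (measure_mono (hS1 y hy)).trans_lt (hS.trans_lt hca)

/-- The radius of the ball whose volume is the rank of `y`. -/
def rankRadius (f : E k → ℝ) (y : E k) : ℝ := ballRadius k (rank f y).toReal

lemma rankRadius_nonneg (y : E k) : 0 ≤ rankRadius f y :=
  ballRadius_nonneg k ENNReal.toReal_nonneg

lemma volume_rankRadius_lt (hk : 1 ≤ k) (hf : Measurable f) (hf0 : ∀ y, 0 ≤ f y)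
    (hfin : ∀ l, 0 < l → volume {w | f w ≤ l} < ∞) (R : ℝ) :
    volume {y | rankRadius f y < R} = volume (ball (0 : E k) R) := by
  rcases le_or_gt R 0 with hR | hR
  · have : {y | rankRadius f y < R} = ∅ := by
      ext y
      simpa using hR.trans (rankRadius_nonneg y)
    rw [this, ball_eq_empty.2 hR]
  · rw [volume_ball_eq hk hR.le]
    rw [← volume_rank_lt hk hf hf0 hfin (a := ENNReal.ofReal (omega k * R ^ k))
      ENNReal.ofReal_lt_top]
    congr 1
    ext y
    simp only [mem_ofPred_eq]
    rw [rankRadius, ballRadius_lt_iff hk ENNReal.toReal_nonneg hR.le,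
      ENNReal.lt_ofReal_iff_toReal_lt (rank_lt_top hfin y).ne]

lemma measurableSet_precSet_prod (hf : Measurable f) :
    MeasurableSet {p : E k × E k | p.2 ∈ precSet f p.1} := by
  have h1 : Measurable fun p : E k × E k => f p.2 := by fun_prop
  have h2 : Measurable fun p : E k × E k => f p.1 := by fun_prop
  exact (measurableSet_lt h1 h2).union ((measurableSet_eq_fun h1 h2).inter
    (measurableSet_lt measurable_snd.norm measurable_fst.norm))

lemma measurable_ballRadius : Measurable (ballRadius k) := by
  unfold ballRadius
  fun_prop

lemma measurable_rankRadius (hf : Measurable f) : Measurable (rankRadius f) :=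
  measurable_ballRadius.comp
    (measurable_measure_prodMk_left (measurableSet_precSet_prod hf)).ennreal_toReal

/-- Both measures agree on the π-system of half-lines `Iio R`, where they are finite. -/
lemma map_rankRadius (hk : 1 ≤ k) (hf : Measurable f) (hf0 : ∀ y, 0 ≤ f y)
    (hfin : ∀ l, 0 < l → volume {w | f w ≤ l} < ∞) :
    Measure.map (rankRadius f) volume = Measure.map (fun y : E k => ‖y‖) volume := by
  have h1 : ∀ R, Measure.map (rankRadius f) volume (Iio R) = volume (ball (0 : E k) R) := fun R => by
    rw [Measure.map_apply (measurable_rankRadius hf) measurableSet_Iio]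
    exact volume_rankRadius_lt hk hf hf0 hfin R
  have h2 : ∀ R, Measure.map (fun y : E k => ‖y‖) volume (Iio R) = volume (ball (0 : E k) R) :=
    fun R => by
      rw [Measure.map_apply measurable_norm measurableSet_Iio]
      congr 1
      ext y
      simp
  refine Measure.ext_of_generateFrom_of_iUnion (range Iio) (fun n : ℕ => Iio (n : ℝ))
    (BorelSpace.measurable_eq.trans (borel_eq_generateFrom_Iio ℝ)) isPiSystem_Iio ?_ ?_ ?_ ?_
  · ext x
    simpa using exists_nat_gt x
  · exact fun n => ⟨n, rfl⟩
  · intro n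
    rw [h1]
    exact measure_ball_lt_top.ne
  · rintro _ ⟨R, rfl⟩
    rw [h1, h2]

end Rank

/-! ### The increasing rearrangement -/

section Rearrangement

variable {k : ℕ} {f : E k → ℝ}

lemma incRearrangement_mono : Monotone (incRearrangement f) := by
  intro t t' htt
  refine le_iInf fun l => le_iInf fun hl => le_iInf fun h => ?_
  exact iInf_le_of_le l (iInf_le_of_le hl
    (iInf_le _ ((ENNReal.ofReal_le_ofReal htt).trans_lt h)))

lemma incRearrangement_le {t l : ℝ} (hl : 0 < l) (h : ENNReal.ofReal t < volume {w | f w ≤ l}) :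
    incRearrangement f t ≤ ENNReal.ofReal l :=
  iInf_le_of_le l (iInf_le_of_le hl (iInf_le _ h))

lemma incRearrangement_ne_top (hk : 1 ≤ k) (t : ℝ) : incRearrangement f t ≠ ∞ := by
  obtain ⟨l, hl, h⟩ := exists_measure_sublevel_gt (g := f)
    (ENNReal.ofReal_lt_top (r := t).trans_eq (volume_univ_eq_top hk).symm)
  -- The level `l` may be `0`, while the infimum runs over positive levels; hence `l + 1`.
  refine ne_top_of_le_ne_top ENNReal.ofReal_ne_top
    (incRearrangement_le (l := l + 1) (by positivity) (h.trans_le (measure_mono fun w (hw : f w ≤ l) => ?_)))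
  exact hw.trans (le_add_of_nonneg_right zero_le_one)

/-- A sublevel set of level `l < f y` lies in `precSet f y`, so its volume cannot exceed the rank of
`y`. -/
lemma le_incRearrangement_rank (hk : 1 ≤ k)
    (hfin : ∀ l, 0 < l → volume {w | f w ≤ l} < ∞) (y : E k) :
    ENNReal.ofReal (f y) ≤ incRearrangement f (omega k * rankRadius f y ^ k) := by
  rw [rankRadius, omega_mul_ballRadius_pow hk ENNReal.toReal_nonneg]
  refine le_iInf fun l => le_iInf fun hl => le_iInf fun h => ?_
  rw [ENNReal.ofReal_toReal (rank_lt_top hfin y).ne] at h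
  refine ENNReal.ofReal_le_ofReal ?_
  by_contra! hc
  exact absurd (measure_mono (μ := volume) fun w (hw : f w ≤ l) => Or.inl (hw.trans_lt hc))
    (not_le.2 h)

/-- The pairing of `f` with a profile of the rank is at most the pairing of the rearrangement
with the radial profile. -/
lemma lintegral_mul_rankRadius_le (hk : 1 ≤ k) (hf : Measurable f) (hf0 : ∀ y, 0 ≤ f y)
    (hfin : ∀ l, 0 < l → volume {w | f w ≤ l} < ∞) {q : ℝ → ℝ≥0∞} (hq : Measurable q) :
    ∫⁻ y, ENNReal.ofReal (f y) * q (rankRadius f y) ≤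
      ∫⁻ y : E k, incRearrangement f (omega k * ‖y‖ ^ k) * q ‖y‖ := by
  have hm : Measurable fun ρ : ℝ => incRearrangement f (omega k * ρ ^ k) * q ρ :=
    (incRearrangement_mono.measurable.comp (by fun_prop)).mul hq
  calc ∫⁻ y, ENNReal.ofReal (f y) * q (rankRadius f y)
      ≤ ∫⁻ y, incRearrangement f (omega k * rankRadius f y ^ k) * q (rankRadius f y) :=
        lintegral_mono fun y => mul_le_mul_left (le_incRearrangement_rank hk hfin y) _
    _ = ∫⁻ ρ, incRearrangement f (omega k * ρ ^ k) * q ρ ∂Measure.map (rankRadius f) volume :=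
        (lintegral_map hm (measurable_rankRadius hf)).symm
    _ = ∫⁻ y : E k, incRearrangement f (omega k * ‖y‖ ^ k) * q ‖y‖ := by
        rw [map_rankRadius hk hf hf0 hfin, lintegral_map hm measurable_norm]

end Rearrangement

/-! ### The Hardy–Littlewood inequality -/

section HardyLittlewood

variable {X Y : Type*} [MeasurableSpace X] [MeasurableSpace Y] {μ : Measure X} {ν : Measure Y}

/-- Layer cake twice: for `g` against the measure of density `f`, then for `f` on `{t < g}`. -/
lemma lintegral_mul_eq_lintegral_meas_inter {f g : X → ℝ} (hf : AEMeasurable f μ)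
    (hf0 : ∀ x, 0 ≤ f x) (hg : AEMeasurable g μ) (hg0 : ∀ x, 0 ≤ g x) :
    ∫⁻ x, ENNReal.ofReal (f x) * ENNReal.ofReal (g x) ∂μ =
      ∫⁻ t in Ioi (0 : ℝ), ∫⁻ l in Ioi (0 : ℝ), μ ({x | l < f x} ∩ {x | t < g x}) := by
  have hac := withDensity_absolutelyContinuous μ fun x => ENNReal.ofReal (f x)
  calc ∫⁻ x, ENNReal.ofReal (f x) * ENNReal.ofReal (g x) ∂μ
      = ∫⁻ x, ENNReal.ofReal (g x) ∂μ.withDensity fun x => ENNReal.ofReal (f x) := by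
        rw [lintegral_withDensity_eq_lintegral_mul₀ hf.ennreal_ofReal hg.ennreal_ofReal]
        rfl
    _ = ∫⁻ t in Ioi (0 : ℝ), (μ.withDensity fun x => ENNReal.ofReal (f x)) {x | t < g x} :=
        lintegral_eq_lintegral_meas_lt _ (ae_of_all _ hg0) (hg.mono_ac hac)
    _ = _ := by
        refine lintegral_congr fun t => ?_
        have ht : NullMeasurableSet {x | t < g x} μ := nullMeasurableSet_lt aemeasurable_const hg
        rw [withDensity_apply₀ _ ht, lintegral_eq_lintegral_meas_lt _ (ae_of_all _ hf0) hf.restrict]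
        refine lintegral_congr fun l => ?_
        rw [Measure.restrict_apply₀']
        exact ht

lemma lintegral_mul_le_of_meas_inter_le {f g : X → ℝ} {f' g' : Y → ℝ} (hf : AEMeasurable f μ)
    (hf0 : ∀ x, 0 ≤ f x) (hg : AEMeasurable g μ) (hg0 : ∀ x, 0 ≤ g x) (hf' : AEMeasurable f' ν)
    (hf0' : ∀ x, 0 ≤ f' x) (hg' : AEMeasurable g' ν) (hg0' : ∀ x, 0 ≤ g' x)
    (h : ∀ l t : ℝ, 0 < l → 0 < t →
      ν ({x | l < f' x} ∩ {x | t < g' x}) ≤ μ ({x | l < f x} ∩ {x | t < g x})) :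
    ∫⁻ x, ENNReal.ofReal (f' x) * ENNReal.ofReal (g' x) ∂ν ≤
      ∫⁻ x, ENNReal.ofReal (f x) * ENNReal.ofReal (g x) ∂μ := by
  rw [lintegral_mul_eq_lintegral_meas_inter hf hf0 hg hg0,
    lintegral_mul_eq_lintegral_meas_inter hf' hf0' hg' hg0']
  refine setLIntegral_mono' measurableSet_Ioi fun t ht => ?_
  exact setLIntegral_mono' measurableSet_Ioi fun l hl => h l t hl ht

/-- The increasing rearrangement minimizes the pairing with functions whose superlevel sets have
the measures of the superlevel sets of a given radial profile. -/
lemma lintegral_incRearrangement_mul_le {k : ℕ} (hk : 1 ≤ k) {f g g₀ : E k → ℝ}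
    (hf : Measurable f) (hf0 : ∀ y, 0 ≤ f y) (hfin : ∀ l, 0 < l → volume {w | f w ≤ l} < ∞)
    (hg : AEMeasurable g) (hg0 : ∀ y, 0 ≤ g y) (hg₀ : Measurable g₀) (hg₀0 : ∀ y, 0 ≤ g₀ y)
    (h : ∀ t, 0 < t → ∃ R, 0 ≤ R ∧ volume {y | t < g y} = volume (ball (0 : E k) R) ∧
      {y | t < g₀ y} ⊆ ball 0 R) :
    ∫⁻ y : E k, incRearrangement f (omega k * ‖y‖ ^ k) * ENNReal.ofReal (g₀ y) ≤
      ∫⁻ y, ENNReal.ofReal (f y) * ENNReal.ofReal (g y) := by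
  have hm : Measurable fun y : E k => incRearrangement f (omega k * ‖y‖ ^ k) :=
    incRearrangement_mono.measurable.comp (by fun_prop)
  have key := lintegral_mul_le_of_meas_inter_le (μ := volume) (ν := volume)
    (f' := fun y : E k => (incRearrangement f (omega k * ‖y‖ ^ k)).toReal) (g' := g₀)
    hf.aemeasurable hf0 hg hg0 hm.ennreal_toReal.aemeasurable (fun _ => ENNReal.toReal_nonneg)
    hg₀.aemeasurable hg₀0 ?_
  · simpa only [ENNReal.ofReal_toReal (incRearrangement_ne_top hk _)] using key
  intro l t hl ht
  obtain ⟨R, hR, hgR, hg₀R⟩ := h t ht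
  set F := volume {w | f w ≤ l} with hF
  have hFfin : F ≠ ∞ := (hfin l hl).ne
  -- Inside the ball of volume `F` the rearrangement is at most `l`, as `l` itself competes in the
  -- infimum.
  have hsub : {y : E k | l < (incRearrangement f (omega k * ‖y‖ ^ k)).toReal} ∩ {y | t < g₀ y} ⊆
      ball 0 R \ ball 0 (ballRadius k F.toReal) := by
    rintro y ⟨hy, hy'⟩
    refine ⟨hg₀R hy', fun hc => ?_⟩
    rw [mem_ball_zero_iff, ← not_le] at hc
    apply hc
    rw [← not_lt]
    intro hc'
    have hlt : ENNReal.ofReal (omega k * ‖y‖ ^ k) < F := by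
      rw [ENNReal.ofReal_lt_iff_lt_toReal (by have := omega_pos k; positivity) hFfin]
      rw [← omega_mul_ballRadius_pow hk (ENNReal.toReal_nonneg (a := F))]
      have := omega_pos k
      gcongr
    have := ENNReal.toReal_mono ENNReal.ofReal_ne_top (incRearrangement_le hl hlt)
    rw [ENNReal.toReal_ofReal hl.le] at this
    exact absurd hy (not_lt.2 this)
  have hball : volume (ball (0 : E k) (ballRadius k F.toReal)) = F := by
    rw [volume_ball_eq hk (ballRadius_nonneg k ENNReal.toReal_nonneg),
      omega_mul_ballRadius_pow hk ENNReal.toReal_nonneg, ENNReal.ofReal_toReal hFfin]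
  refine (measure_mono hsub).trans ?_
  rcases le_or_gt R (ballRadius k F.toReal) with hle | hgt
  · rw [sdiff_eq_empty.2 (ball_subset_ball hle)]
    simp
  rw [measure_sdiff (ball_subset_ball hgt.le) measurableSet_ball.nullMeasurableSet (by rwa [hball]),
    hball, ← hgR, tsub_le_iff_right]
  -- `{t < g}` is covered by the intersection and `{f ≤ l}`.
  refine (measure_mono fun y hy => ?_).trans (measure_union_le _ _)
  rcases le_or_gt (f y) l with h1 | h1
  · exact Or.inr h1
  · exact Or.inl ⟨h1, hy⟩

end HardyLittlewood

/-! ### Splitting the variables -/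

section Split

variable {k m : ℕ}

@[simp] lemma yPart_pt (y : E k) (z : E m) : yPart (pt y z) = y := by
  ext i
  simp [yPart, pt]

@[simp] lemma zPart_pt (y : E k) (z : E m) : zPart (pt y z) = z := by
  ext i
  simp [zPart, pt]

@[simp] lemma pt_yPart_zPart (x : E (k + m)) : pt (yPart x) (zPart x) = x := by
  ext i
  refine Fin.addCases (fun j => ?_) (fun j => ?_) i <;> simp [yPart, zPart, pt]

lemma norm_pt_sq (y : E k) (z : E m) : ‖pt y z‖ ^ 2 = ‖y‖ ^ 2 + ‖z‖ ^ 2 := by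
  simp [EuclideanSpace.norm_sq_eq, Fin.sum_univ_add, pt]

lemma measurable_yPart : Measurable (yPart : E (k + m) → E k) := by
  unfold yPart
  fun_prop

lemma measurable_zPart : Measurable (zPart : E (k + m) → E m) := by
  unfold zPart
  fun_prop

lemma continuous_pt : Continuous fun p : E k × E m => pt p.1 p.2 := by
  unfold pt
  refine (PiLp.continuous_toLp 2 _).comp (continuous_pi fun i => ?_)
  refine Fin.addCases (fun j => ?_) (fun j => ?_) i <;> simp <;> fun_prop

lemma measurePreserving_pt :
    MeasurePreserving (fun p : E k × E m => pt p.1 p.2) volume volume := by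
  have h1 : MeasurePreserving
      (Prod.map (WithLp.ofLp : E k → Fin k → ℝ) (WithLp.ofLp : E m → Fin m → ℝ)) volume volume :=
    (PiLp.volume_preserving_ofLp (Fin k)).prod (PiLp.volume_preserving_ofLp (Fin m))
  have h2 := volume_measurePreserving_sumPiEquivProdPi_symm (fun _ : Fin k ⊕ Fin m => ℝ)
  have h3 := volume_measurePreserving_piCongrLeft (fun _ : Fin (k + m) => ℝ) finSumFinEquiv
  have h4 := PiLp.volume_preserving_toLp (Fin (k + m))
  have h := h4.comp (h3.comp (h2.comp h1))
  suffices heq : (fun p : E k × E m => pt p.1 p.2) = _ from heq ▸ h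
  funext p
  refine congrArg (WithLp.toLp 2) (funext fun i => ?_)
  refine Fin.addCases (fun j => ?_) (fun j => ?_) i
  · rw [Fin.append_left]
    conv_rhs => rw [← finSumFinEquiv_apply_left]
    simp only [Function.comp_apply]
    erw [MeasurableEquiv.piCongrLeft_apply_apply]
    rfl
  · rw [Fin.append_right]
    conv_rhs => rw [← finSumFinEquiv_apply_right]
    simp only [Function.comp_apply]
    erw [MeasurableEquiv.piCongrLeft_apply_apply]
    rfl

lemma lintegral_eq_lintegral_slices {f : E (k + m) → ℝ≥0∞} (hf : AEMeasurable f) :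
    ∫⁻ x, f x = ∫⁻ z : E m, ∫⁻ y : E k, f (pt y z) := by
  have hmp := measurePreserving_pt (k := k) (m := m)
  rw [← hmp.map_eq, lintegral_map' (by rwa [hmp.map_eq]) hmp.measurable.aemeasurable]
  exact lintegral_prod_symm _ (hf.comp_quasiMeasurePreserving hmp.quasiMeasurePreserving)

lemma lintegral_mul_eq_lintegral_slices {f g : E (k + m) → ℝ≥0∞} (hf : AEMeasurable f)
    (hg : AEMeasurable g) :
    ∫⁻ x, f x * g x = ∫⁻ z : E m, ∫⁻ y : E k, f (pt y z) * g (pt y z) :=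
  lintegral_eq_lintegral_slices (hf.mul hg)

/-- Kernels are only a.e. measurable; a measurable representative agrees with them a.e. on almost
every slice. -/
lemma ae_aemeasurable_slice {β : Type*} [MeasurableSpace β] {f : E (k + m) → β}
    (hf : AEMeasurable f) : ∀ᵐ z : E m, AEMeasurable fun y : E k => f (pt y z) := by
  have hmp := measurePreserving_pt (k := k) (m := m)
  obtain ⟨g, hg, hfg⟩ := hf
  have h1 : ∀ᵐ p : E k × E m, f (pt p.1 p.2) = g (pt p.1 p.2) :=
    hmp.quasiMeasurePreserving.ae hfg
  have h2 : ∀ᵐ p : E m × E k, f (pt p.2 p.1) = g (pt p.2 p.1) :=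
    (Measure.measurePreserving_swap (μ := (volume : Measure (E m)))
      (ν := (volume : Measure (E k)))).quasiMeasurePreserving.ae h1
  filter_upwards [Measure.ae_ae_of_ae_prod h2] with z hz
  exact ⟨fun y => g (pt y z),
    hg.comp (continuous_pt.measurable.comp (measurable_id.prodMk measurable_const)), hz⟩

end Split

/-! ### Kernels -/

/-- The function `(ρ² + b²)^(-p/2)`. -/
def profile (p b ρ : ℝ) : ℝ := (ρ ^ 2 + b ^ 2) ^ (-p / 2)

lemma profile_nonneg (p b ρ : ℝ) : 0 ≤ profile p b ρ := Real.rpow_nonneg (by positivity) _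

lemma measurable_profile (p b : ℝ) : Measurable (profile p b) := by
  unfold profile
  fun_prop

lemma profile_norm_pt {k m : ℕ} (p : ℝ) (x : E (k + m)) :
    profile p ‖zPart x‖ ‖yPart x‖ = 1 / ‖x‖ ^ p := by
  rw [profile, ← norm_pt_sq, pt_yPart_zPart, ← Real.rpow_natCast, ← Real.rpow_mul (norm_nonneg _),
    one_div, ← Real.rpow_neg (norm_nonneg _)]
  congr 1
  push_cast
  ring

/-- Real powers give `0 ^ (-p / 2) = 0`, so the profile vanishes at `ρ = b = 0` instead of blowing
up; hence the positivity condition. -/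
lemma rpow_neg_lt_profile_iff {p b ρ r : ℝ} (hp : 0 < p) (hr : 0 < r) :
    r ^ (-p) < profile p b ρ ↔ 0 < ρ ^ 2 + b ^ 2 ∧ ρ ^ 2 + b ^ 2 < r ^ 2 := by
  have hr2 : r ^ (-p) = (r ^ 2) ^ (-p / 2) := by
    rw [← Real.rpow_natCast, ← Real.rpow_mul hr.le]
    congr 1
    push_cast
    ring
  rw [profile, hr2]
  have h0 : 0 ≤ ρ ^ 2 + b ^ 2 := by positivity
  rcases h0.eq_or_lt with h | h
  · rw [← h, Real.zero_rpow (by linarith)]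
    simp only [lt_irrefl, false_and, iff_false, not_lt]
    positivity
  · rw [Real.rpow_lt_rpow_iff_of_neg (by positivity) h (by linarith)]
    simp [h]

section Kernels

variable {k m : ℕ}

lemma volume_rpow_neg_lt_profile (hk : 1 ≤ k) {p r : ℝ} (hp : 0 < p) (hr : 0 < r) (z : E m) :
    volume {y : E k | r ^ (-p) < profile p ‖z‖ ‖y‖} =
      volume (ball (0 : E k) (√(r ^ 2 - ‖z‖ ^ 2))) := by
  have : Nonempty (Fin k) := ⟨⟨0, hk⟩⟩
  apply le_antisymm
  · refine measure_mono fun y hy => ?_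
    have := ((rpow_neg_lt_profile_iff hp hr).1 hy).2
    rw [mem_ball_zero_iff]
    exact Real.lt_sqrt_of_sq_lt (by linarith)
  · rw [← measure_sdiff_null (measure_singleton (μ := (volume : Measure (E k))) 0)]
    refine measure_mono fun y hy => ?_
    rw [Set.mem_sdiff, mem_ball_zero_iff, mem_singleton_iff] at hy
    have hy0 : 0 < ‖y‖ := norm_pos_iff.2 hy.2
    have := (Real.lt_sqrt hy0.le).1 hy.1
    exact (rpow_neg_lt_profile_iff hp hr).2 ⟨by positivity, by linarith⟩

/-- For `‖z‖ ≥ r` the square root is `0` and the ball is empty, so the case split in `Kernels` is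
redundant. -/
lemma ite_volume_ball_sqrt {r : ℝ} (hr : 0 < r) (z : E m) :
    (if ‖z‖ < r then volume (ball (0 : E k) (√(r ^ 2 - ‖z‖ ^ 2))) else 0) =
      volume (ball (0 : E k) (√(r ^ 2 - ‖z‖ ^ 2))) := by
  split_ifs with h
  · rfl
  · have : r ^ 2 - ‖z‖ ^ 2 ≤ 0 := by nlinarith [not_lt.1 h]
    rw [Real.sqrt_eq_zero_of_nonpos this]
    simp

/-- A profile of functions equimeasurable with the norm on each slice is admissible. -/
lemma profile_mem_Kernels (hk : 1 ≤ k) {s : ℝ} (hs : 0 < s) {τ : E m → E k → ℝ}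
    (hτ : Measurable fun x : E (k + m) => τ (zPart x) (yPart x))
    (hτm : ∀ z, Measurable (τ z))
    (hτe : ∀ z, Measure.map (τ z) volume = Measure.map (fun y : E k => ‖y‖) volume) :
    (fun x : E (k + m) =>
      (profile (((k + m : ℕ) : ℝ) + 2 * s) ‖zPart x‖ (τ (zPart x) (yPart x))).toNNReal) ∈
      Kernels k m s := by
  set p := ((k + m : ℕ) : ℝ) + 2 * s with hp
  have hp0 : 0 < p := by positivity
  refine ⟨?_, fun z r hr => ?_⟩
  · have := (measurable_zPart (k := k) (m := m)).norm
    have : Measurable fun x : E (k + m) => profile p ‖zPart x‖ (τ (zPart x) (yPart x)) := by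
      unfold profile
      exact ((hτ.pow_const 2).add (this.pow_const 2)).pow_const _
    exact this.real_toNNReal.aemeasurable
  · rw [ite_volume_ball_sqrt hr, ← volume_rpow_neg_lt_profile hk hp0 hr]
    simp only [yPart_pt, zPart_pt, Real.coe_toNNReal _ (profile_nonneg _ _ _)]
    have he : -((k + m : ℕ) : ℝ) - 2 * s = -p := by rw [hp]; ring
    have hS : MeasurableSet {ρ | r ^ (-p) < profile p ‖z‖ ρ} :=
      measurableSet_lt measurable_const (measurable_profile _ _)
    have h1 := Measure.map_apply (μ := volume) (hτm z) hS
    have h2 := Measure.map_apply (μ := (volume : Measure (E k))) measurable_norm hS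
    rw [he]
    rw [hτe, h2] at h1
    exact h1.symm

/-- On almost every slice, the rearrangement paired with `|x|^(-n-2s)` bounds from below the
pairing with an admissible kernel. -/
lemma lintegral_incRearrangement_le_of_mem_Kernels (hk : 1 ≤ k) {s : ℝ} (hs : 0 < s)
    {K : E (k + m) → ℝ≥0} (hK : K ∈ Kernels k m s) {f : E k → ℝ} (hf : Measurable f)
    (hf0 : ∀ y, 0 ≤ f y) (hfin : ∀ l, 0 < l → volume {w | f w ≤ l} < ∞) (z : E m)
    (hKz : AEMeasurable fun y : E k => K (pt y z)) :
    ∫⁻ y : E k, incRearrangement f (omega k * ‖y‖ ^ k) *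
        ENNReal.ofReal (profile (((k + m : ℕ) : ℝ) + 2 * s) ‖z‖ ‖y‖) ≤
      ∫⁻ y, ENNReal.ofReal (f y) * ENNReal.ofReal (K (pt y z)) := by
  set p := ((k + m : ℕ) : ℝ) + 2 * s with hp
  have hp0 : 0 < p := by positivity
  refine lintegral_incRearrangement_mul_le hk hf hf0 hfin hKz.coe_nnreal_real
    (fun _ => NNReal.coe_nonneg _)
    ((measurable_profile _ _).comp measurable_norm) (fun _ => profile_nonneg _ _ _)
    fun t ht => ?_
  -- Chosen so that `r ^ (-p) = t`, the form of level used in `Kernels`.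
  set r := t ^ (-p⁻¹) with hr
  have hr0 : 0 < r := Real.rpow_pos_of_pos ht _
  have hrt : r ^ (-p) = t := by
    rw [hr, ← Real.rpow_mul ht.le, neg_mul_neg, inv_mul_cancel₀ hp0.ne', Real.rpow_one]
  refine ⟨√(r ^ 2 - ‖z‖ ^ 2), Real.sqrt_nonneg _, ?_, fun y hy => ?_⟩
  · rw [← ite_volume_ball_sqrt hr0, ← hK.2 z r hr0]
    have he : -((k + m : ℕ) : ℝ) - 2 * s = -p := by rw [hp]; ring
    rw [he, hrt]
  · have hy : t < profile p ‖z‖ ‖y‖ := hy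
    rw [← hrt, rpow_neg_lt_profile_iff hp0 hr0] at hy
    rw [mem_ball_zero_iff]
    exact Real.lt_sqrt_of_sq_lt (by linarith [hy.2])

end Kernels

/-! ### Integrability of the Taylor remainder -/

section Remainder

variable {d : ℕ} {u : E d → ℝ} {x₀ : E d}

lemma tilde_zero : tilde u x₀ 0 = 0 := by
  simp [tilde]

lemma continuous_tilde (hu : Continuous u) : Continuous (tilde u x₀) := by
  unfold tilde
  fun_prop

/-- A quadratic error is `o(‖x‖)`, so the vector in `IsC11At` is the gradient. -/
lemma IsC11At.exists_tilde_le (h : IsC11At u x₀) :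
    ∃ ρ, 0 < ρ ∧ ∃ C, 0 < C ∧ ∀ x ∈ ball (0 : E d) ρ, |tilde u x₀ x| ≤ C * ‖x‖ ^ 2 := by
  obtain ⟨p, ρ, hρ, C, hC, hb⟩ := h
  have hg : HasGradientAt u p x₀ := by
    rw [hasGradientAt_iff_isLittleO_nhds_zero]
    have hO : (fun h : E d => u (x₀ + h) - u x₀ - inner ℝ p h) =O[𝓝 0] fun h => ‖h‖ ^ 2 := by
      refine Asymptotics.IsBigO.of_bound C ?_
      filter_upwards [ball_mem_nhds (0 : E d) hρ] with x hx
      rw [Real.norm_eq_abs, Real.norm_of_nonneg (by positivity), real_inner_comm]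
      exact hb x hx
    exact hO.trans_isLittleO (Asymptotics.isLittleO_norm_pow_id one_lt_two)
  refine ⟨ρ, hρ, C, hC, fun x hx => ?_⟩
  rw [tilde, hg.gradient]
  exact hb x hx

lemma abs_tilde_le (x : E d) :
    |tilde u x₀ x| ≤ |u (x₀ + x)| + (|u x₀| + ‖gradient u x₀‖) * (1 + ‖x‖) := by
  have h1 := abs_sub (u (x₀ + x) - u x₀) (inner ℝ x (gradient u x₀))
  have h2 := abs_sub (u (x₀ + x)) (u x₀)
  have h3 := abs_real_inner_le_norm x (gradient u x₀)
  have h4 := norm_nonneg (gradient u x₀)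
  have h5 := mul_nonneg (abs_nonneg (u x₀)) (norm_nonneg x)
  rw [tilde]
  linarith

lemma integrable_tilde_mul (hd : 1 ≤ d) {s : ℝ} (hs : 1 / 2 < s) (hs' : s < 1)
    (hu : Continuous u) (hu' : IsC11At u x₀)
    (hP : Integrable (fun x : E d => |u x| / (1 + ‖x‖) ^ ((d : ℝ) + 2 * s))) :
    Integrable fun x : E d => tilde u x₀ x * (1 / ‖x‖ ^ ((d : ℝ) + 2 * s)) := by
  set p := (d : ℝ) + 2 * s with hp
  have hp0 : 0 < p := by positivity
  obtain ⟨ρ, hρ, C, hC, hb⟩ := hu'.exists_tilde_le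
  have hmeas : AEStronglyMeasurable fun x : E d => tilde u x₀ x * (1 / ‖x‖ ^ p) :=
    ((continuous_tilde hu).measurable.mul (by fun_prop)).aestronglyMeasurable
  -- The integrand is `O(‖x‖ ^ (2 - p))`, integrable near `0` because `p - 2 < d`, that is, `s < 1`.
  have hnear : IntegrableOn (fun x : E d => tilde u x₀ x * (1 / ‖x‖ ^ p)) (ball 0 ρ) := by
    refine integrableOn_ball_of_norm_le_rpow (C := C) (α := p - 2) (by simpa using hd)
      (by simp only [finrank_euclideanSpace_fin]; linarith) ?_ hmeas
    filter_upwards [ae_restrict_mem measurableSet_ball] with x hx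
    rw [norm_mul, Real.norm_eq_abs, Real.norm_of_nonneg (by positivity)]
    rcases (norm_nonneg x).eq_or_lt with h0 | h0
    · rw [norm_eq_zero.1 h0.symm, tilde_zero, abs_zero, zero_mul]
      positivity
    · refine (mul_le_mul_of_nonneg_right (hb x hx) (by positivity)).trans_eq ?_
      rw [neg_sub, Real.rpow_sub h0, Real.rpow_two]
      ring
  have hfar : IntegrableOn (fun x : E d => tilde u x₀ x * (1 / ‖x‖ ^ p)) (ball 0 ρ)ᶜ := by
    have i1 : Integrable fun x : E d => |u (x₀ + x)| / (1 + ‖x₀ + x‖) ^ p :=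
      hP.comp_add_left x₀
    -- This controls the linear growth of the Taylor polynomial; it needs `p - 1 > d`, that is, `s >
    -- 1/2`.
    have i2 : Integrable fun x : E d => (1 + ‖x‖) ^ (-(p - 1)) := by
      refine integrable_one_add_norm ?_
      simp only [finrank_euclideanSpace_fin]
      linarith
    -- With this `M`, `1 + ‖x‖ ≤ M * ‖x‖` whenever `‖x‖ ≥ ρ`.
    set M := (1 + ρ) / ρ with hM
    set B := |u x₀| + ‖gradient u x₀‖ with hB
    refine Integrable.mono' (((i1.const_mul ((1 + ‖x₀‖) ^ p)).add
      (i2.const_mul B)).const_mul (M ^ p)).integrableOn hmeas.restrict ?_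
    filter_upwards [ae_restrict_mem measurableSet_ball.compl] with x hx
    have hx' : ρ ≤ ‖x‖ := by simpa using hx
    have hx0 : 0 < ‖x‖ := hρ.trans_le hx'
    have e1 : 1 / ‖x‖ ^ p ≤ M ^ p * (1 / (1 + ‖x‖) ^ p) := by
      rw [mul_one_div, div_le_div_iff₀ (by positivity) (by positivity), one_mul,
        ← Real.mul_rpow (by positivity) hx0.le]
      refine Real.rpow_le_rpow (by positivity) ?_ hp0.le
      rw [hM, div_mul_eq_mul_div, le_div_iff₀ hρ]
      nlinarith
    have e2 : 1 / (1 + ‖x‖) ^ p ≤ (1 + ‖x₀‖) ^ p * (1 / (1 + ‖x₀ + x‖) ^ p) := by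
      rw [mul_one_div, div_le_div_iff₀ (by positivity) (by positivity), one_mul,
        ← Real.mul_rpow (by positivity) (by positivity)]
      refine Real.rpow_le_rpow (by positivity) ?_ hp0.le
      nlinarith [norm_add_le x₀ x, norm_nonneg x₀]
    have e3 : (1 + ‖x‖) * (1 / (1 + ‖x‖) ^ p) = (1 + ‖x‖) ^ (-(p - 1)) := by
      rw [neg_sub, Real.rpow_sub (by positivity), Real.rpow_one, mul_one_div]
    rw [norm_mul, Real.norm_eq_abs, Real.norm_of_nonneg (by positivity)]
    calc |tilde u x₀ x| * (1 / ‖x‖ ^ p)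
        ≤ (|u (x₀ + x)| + B * (1 + ‖x‖)) * (M ^ p * (1 / (1 + ‖x‖) ^ p)) :=
          mul_le_mul (abs_tilde_le x) e1 (by positivity) (by positivity)
      _ = M ^ p * (|u (x₀ + x)| * (1 / (1 + ‖x‖) ^ p) +
            B * ((1 + ‖x‖) * (1 / (1 + ‖x‖) ^ p))) := by ring
      _ ≤ M ^ p * (|u (x₀ + x)| * ((1 + ‖x₀‖) ^ p * (1 / (1 + ‖x₀ + x‖) ^ p)) +
            B * ((1 + ‖x‖) * (1 / (1 + ‖x‖) ^ p))) := by gcongr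
      _ = M ^ p * ((1 + ‖x₀‖) ^ p * (|u (x₀ + x)| / (1 + ‖x₀ + x‖) ^ p) +
            B * (1 + ‖x‖) ^ (-(p - 1))) := by rw [e3]; ring
  rw [← integrableOn_univ, ← union_compl_self (ball (0 : E d) ρ)]
  exact hnear.union hfar

end Remainder

/-! ### Measurability in both variables -/

section Measurability

variable {k m : ℕ} {v : E (k + m) → ℝ}

/-- Rational levels suffice since sublevel sets grow with the level; the countable union yields
joint measurability in `(y, z)`. -/
lemma incRearrangement_lt_iff {f : E k → ℝ} {t : ℝ} {a : ℝ≥0∞} :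
    incRearrangement f t < a ↔ ∃ q : ℚ, 0 < (q : ℝ) ∧ ENNReal.ofReal q < a ∧
      ENNReal.ofReal t < volume {w | f w ≤ q} := by
  constructor
  · intro h
    simp only [incRearrangement, iInf_lt_iff] at h
    obtain ⟨l, hl, hlt, hla⟩ := h
    obtain ⟨q, -, hlq, hqa⟩ := ENNReal.lt_iff_exists_rat_btwn.1 hla
    have hlq' : l < q := (ENNReal.ofReal_lt_ofReal_iff_of_nonneg hl.le).1 hlq
    exact ⟨q, hl.trans hlq', hqa,
      hlt.trans_le (measure_mono fun w (hw : f w ≤ l) => hw.trans hlq'.le)⟩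
  · rintro ⟨q, hq, hqa, h⟩
    exact (incRearrangement_le hq h).trans_lt hqa

lemma measurable_slice (hv : Measurable v) (z : E m) : Measurable fun w : E k => v (pt w z) :=
  hv.comp (continuous_pt.measurable.comp (measurable_id.prodMk measurable_const))

lemma measurable_slice_prod (hv : Measurable v) :
    Measurable fun q : E (k + m) × E k => v (pt q.2 (zPart q.1)) :=
  hv.comp (continuous_pt.measurable.comp
    (measurable_snd.prodMk (measurable_zPart.comp measurable_fst)))

lemma measurable_kIncRearrangement (hv : Measurable v) : Measurable (kIncRearrangement k m v) := by
  refine measurable_of_Iio fun a => ?_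
  have : kIncRearrangement k m v ⁻¹' Iio a = ⋃ q : ℚ, {x | (0 < (q : ℝ) ∧ ENNReal.ofReal q < a) ∧
      ENNReal.ofReal (omega k * ‖yPart x‖ ^ k) < volume {w : E k | v (pt w (zPart x)) ≤ q}} := by
    ext x
    simp only [mem_preimage, mem_Iio, kIncRearrangement, incRearrangement_lt_iff, mem_iUnion,
      mem_ofPred_eq, and_assoc]
  rw [this]
  refine MeasurableSet.iUnion fun q => MeasurableSet.inter (MeasurableSet.const _) ?_
  refine measurableSet_lt ?_ (measurable_measure_prodMk_left
    (measurableSet_le (measurable_slice_prod hv) measurable_const))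
  have := (measurable_yPart (k := k) (m := m)).norm
  fun_prop

/-- Joint measurability makes the extremal kernel measurable on the whole space; the rank is the
volume of a section of a measurable set. -/
lemma measurable_rankRadius_slice (hv : Measurable v) :
    Measurable fun x : E (k + m) => rankRadius (fun w => v (pt w (zPart x))) (yPart x) := by
  have h1 := measurable_slice_prod (k := k) (m := m) hv
  have h2 : Measurable fun q : E (k + m) × E k => v (pt (yPart q.1) (zPart q.1)) := by
    simp only [pt_yPart_zPart]
    exact hv.comp measurable_fst
  exact measurable_ballRadius.comp (measurable_measure_prodMk_left
    ((measurableSet_lt h1 h2).union ((measurableSet_eq_fun h1 h2).inter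
      (measurableSet_lt measurable_snd.norm
        (measurable_yPart.comp measurable_fst).norm)))).ennreal_toReal

end Measurability

/-! ### The extremal value -/

section Extremal

variable {k m : ℕ} {v : E (k + m) → ℝ} {s : ℝ}

lemma lintegral_kIncRearrangement_mul (hv : Measurable v) (p : ℝ) :
    ∫⁻ x, kIncRearrangement k m v x * ENNReal.ofReal (1 / ‖x‖ ^ p) =
      ∫⁻ z : E m, ∫⁻ y : E k, incRearrangement (fun w => v (pt w z)) (omega k * ‖y‖ ^ k) *
        ENNReal.ofReal (profile p ‖z‖ ‖y‖) := by
  rw [lintegral_mul_eq_lintegral_slices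
    (measurable_kIncRearrangement hv).aemeasurable (by fun_prop)]
  simp only [← profile_norm_pt, kIncRearrangement, yPart_pt, zPart_pt]

lemma lintegral_kIncRearrangement_le (hk : 1 ≤ k) (hs : 0 < s) (hv : Measurable v)
    (hv0 : ∀ x, 0 ≤ v x) (hfin : ∀ l, 0 < l → ∀ z : E m, volume {w : E k | v (pt w z) ≤ l} < ∞)
    {K : E (k + m) → ℝ≥0} (hK : K ∈ Kernels k m s) :
    ∫⁻ x, kIncRearrangement k m v x * ENNReal.ofReal (1 / ‖x‖ ^ (((k + m : ℕ) : ℝ) + 2 * s)) ≤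
      ∫⁻ x, ENNReal.ofReal (v x) * ENNReal.ofReal (K x) := by
  rw [lintegral_kIncRearrangement_mul hv, lintegral_mul_eq_lintegral_slices
    hv.ennreal_ofReal.aemeasurable hK.1.coe_nnreal_real.ennreal_ofReal]
  refine lintegral_mono_ae ?_
  filter_upwards [ae_aemeasurable_slice hK.1] with z hz
  exact lintegral_incRearrangement_le_of_mem_Kernels hk hs hK (measurable_slice hv z)
    (fun y => hv0 _) (fun l hl => hfin l hl z) z hz

/-- The infimum over the admissible kernels is attained. -/
lemma exists_mem_Kernels_lintegral_le (hk : 1 ≤ k) (hs : 0 < s) (hv : Measurable v)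
    (hv0 : ∀ x, 0 ≤ v x)
    (hfin : ∀ l, 0 < l → ∀ z : E m, volume {w : E k | v (pt w z) ≤ l} < ∞) :
    ∃ K ∈ Kernels k m s, ∫⁻ x, ENNReal.ofReal (v x) * ENNReal.ofReal (K x) ≤
      ∫⁻ x, kIncRearrangement k m v x *
        ENNReal.ofReal (1 / ‖x‖ ^ (((k + m : ℕ) : ℝ) + 2 * s)) := by
  have hK := profile_mem_Kernels hk hs (measurable_rankRadius_slice hv)
    (fun z => measurable_rankRadius (measurable_slice hv z))
    (fun z => map_rankRadius hk (measurable_slice hv z) (fun y => hv0 _) fun l hl => hfin l hl z)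
  refine ⟨_, hK, ?_⟩
  rw [lintegral_kIncRearrangement_mul hv, lintegral_mul_eq_lintegral_slices
    hv.ennreal_ofReal.aemeasurable hK.1.coe_nnreal_real.ennreal_ofReal]
  refine lintegral_mono fun z => ?_
  simp only [yPart_pt, zPart_pt, Real.coe_toNNReal _ (profile_nonneg _ _ _)]
  exact lintegral_mul_rankRadius_le hk (measurable_slice hv z) (fun y => hv0 _)
    (fun l hl => hfin l hl z) (measurable_profile _ _).ennreal_ofReal

/-- The kernel `|x|^(-n-2s)` is admissible. -/
lemma norm_rpow_mem_Kernels (hk : 1 ≤ k) (hs : 0 < s) :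
    (fun x : E (k + m) => (1 / ‖x‖ ^ (((k + m : ℕ) : ℝ) + 2 * s)).toNNReal) ∈
      Kernels k m s := by
  simpa only [profile_norm_pt] using profile_mem_Kernels hk hs
    (τ := fun (_ : E m) (y : E k) => ‖y‖) measurable_yPart.norm (fun _ => measurable_norm)
    fun _ => rfl

lemma extIntegral_of_nonneg {d : ℕ} {f : E d → ℝ} (hf : ∀ x, 0 ≤ f x) :
    extIntegral f = ((∫⁻ x, ENNReal.ofReal (f x) : ℝ≥0∞) : EReal) := by
  have : ∀ x, ENNReal.ofReal (-f x) = 0 := fun x =>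
    ENNReal.ofReal_of_nonpos (neg_nonpos.2 (hf x))
  simp [extIntegral, this]

lemma iInf_extIntegral (hk : 1 ≤ k) (hs : 0 < s) (hv : Measurable v) (hv0 : ∀ x, 0 ≤ v x)
    (hfin : ∀ l, 0 < l → ∀ z : E m, volume {w : E k | v (pt w z) ≤ l} < ∞) :
    ⨅ K ∈ Kernels k m s, extIntegral (fun x => v x * (K x : ℝ)) =
      ((∫⁻ x, kIncRearrangement k m v x *
        ENNReal.ofReal (1 / ‖x‖ ^ (((k + m : ℕ) : ℝ) + 2 * s)) : ℝ≥0∞) : EReal) := by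
  have hext : ∀ K : E (k + m) → ℝ≥0, extIntegral (fun x => v x * (K x : ℝ)) =
      ((∫⁻ x, ENNReal.ofReal (v x) * ENNReal.ofReal (K x) : ℝ≥0∞) : EReal) := fun K => by
    rw [extIntegral_of_nonneg fun x => mul_nonneg (hv0 x) (NNReal.coe_nonneg _)]
    simp only [ENNReal.ofReal_mul (hv0 _)]
  simp only [hext]
  apply le_antisymm
  · obtain ⟨K, hK, hle⟩ := exists_mem_Kernels_lintegral_le hk hs hv hv0 hfin
    exact iInf₂_le_of_le K hK (EReal.coe_ennreal_le_coe_ennreal_iff.2 hle)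
  · exact le_iInf₂ fun K hK => EReal.coe_ennreal_le_coe_ennreal_iff.2
      (lintegral_kIncRearrangement_le hk hs hv hv0 hfin hK)

/-- By continuity each positive sublevel set on the slice through the origin contains a nonempty
open set, hence has positive volume. -/
lemma kIncRearrangement_zero (hk : 1 ≤ k) (hv : Continuous v) (hv0 : v 0 = 0) :
    kIncRearrangement k m v 0 = 0 := by
  have hy : (yPart (0 : E (k + m)) : E k) = 0 := by ext i; simp [yPart]
  have hpt : pt (0 : E k) (zPart (0 : E (k + m)) : E m) = 0 := by
    rw [← hy, pt_yPart_zPart]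
  have key : ∀ l : ℝ, 0 < l → kIncRearrangement k m v 0 ≤ ENNReal.ofReal l := by
    intro l hl
    refine incRearrangement_le hl ?_
    · rw [hy, norm_zero, zero_pow (by omega), mul_zero, ENNReal.ofReal_zero]
      have hc : Continuous fun w : E k => v (pt w (zPart (0 : E (k + m)))) :=
        hv.comp (continuous_pt.comp (continuous_id.prodMk continuous_const))
      refine ((isOpen_lt hc continuous_const).measure_pos volume ⟨0, ?_⟩).trans_le
        (measure_mono fun w (hw : v (pt w _) < l) => hw.le)
      simpa only [mem_ofPred_eq, hpt, hv0] using hl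
  refine le_antisymm (ENNReal.le_of_forall_pos_le_add fun ε hε _ => ?_) zero_le
  simpa using key ε hε

end Extremal

/-! ### The fractional Laplacian of a nonnegative function vanishing at the point -/

/-- The sets `{ε < ‖x‖}` exhaust the space up to the null set `{0}`, so dominated convergence gives
the limit with no cancellation. -/
lemma hasFracLaplacianAt_of_integrable {d : ℕ} {s : ℝ} (hd : 1 ≤ d) {w : E d → ℝ} (hw0 : w 0 = 0)
    (hw : Integrable fun x : E d => w x * (1 / ‖x‖ ^ ((d : ℝ) + 2 * s))) :
    HasFracLaplacianAt s w 0
      (fracConst d s * ∫ x : E d, w x * (1 / ‖x‖ ^ ((d : ℝ) + 2 * s))) := by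
  have : Nonempty (Fin d) := ⟨⟨0, hd⟩⟩
  have hcover : AECover (volume : Measure (E d)) (𝓝[>] (0 : ℝ)) fun ε => {x : E d | ε < ‖x‖} := by
    refine ⟨?_, fun ε => measurableSet_lt measurable_const measurable_norm⟩
    filter_upwards [compl_mem_ae_iff.2 (measure_singleton (μ := (volume : Measure (E d))) 0)]
      with x hx
    exact mem_nhdsWithin_of_mem_nhds (Iio_mem_nhds (norm_pos_iff.2 hx))
  simp only [HasFracLaplacianAt, zero_add, hw0, sub_zero]
  exact ⟨fun ε _ => hw.integrableOn,
    (hcover.integral_tendsto_of_countably_generated hw).const_mul _⟩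

end FracMA

end

theorem corollary4p4 (k m : ℕ) (hk : 1 ≤ k) (hm : 1 ≤ m) (s : ℝ) (hs : 1 / 2 < s) (hs' : s < 1)
    (u : FracMA.E (k + m) → ℝ) (x₀ : FracMA.E (k + m))
    (hu : Continuous u) (hu' : FracMA.IsC11At u x₀)
    (hP1 : Integrable
      (fun x : FracMA.E (k + m) => |u x| / (1 + ‖x‖) ^ (((k + m : ℕ) : ℝ) + 2 * s)) volume)
    (hP2 : ∀ x : FracMA.E (k + m), 0 ≤ FracMA.tilde u x₀ x)
    (hlevel : ∀ l : ℝ, 0 < l → ∀ z : FracMA.E m,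
      volume {y : FracMA.E k | FracMA.tilde u x₀ (FracMA.pt y z) ≤ l} < ∞) :
    (∀ x : FracMA.E (k + m), FracMA.kIncRearrangement k m (FracMA.tilde u x₀) x ≠ ∞) ∧
    ∃ L : ℝ,
      FracMA.HasFracLaplacianAt s
        (fun x => (FracMA.kIncRearrangement k m (FracMA.tilde u x₀) x).toReal) 0 L ∧
      FracMA.Fop k m s u x₀ = (L : EReal) := by
  have hs0 : 0 < s := by linarith
  have hc : Continuous (FracMA.tilde u x₀) := FracMA.continuous_tilde hu
  have hv := hc.measurable
  have hne : ∀ x, FracMA.kIncRearrangement k m (FracMA.tilde u x₀) x ≠ ∞ := fun x =>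
    FracMA.incRearrangement_ne_top hk _
  refine ⟨hne, ?_⟩
  set p := ((k + m : ℕ) : ℝ) + 2 * s with hp
  set I := ∫⁻ x, FracMA.kIncRearrangement k m (FracMA.tilde u x₀) x *
    ENNReal.ofReal (1 / ‖x‖ ^ p) with hI
  have hint := FracMA.integrable_tilde_mul (le_add_right hk) hs hs' hu hu' hP1
  -- The lower bound is tested on the admissible kernel `‖x‖ ^ (-p)`.
  have hIfin : I ≠ ∞ := by
    refine ne_top_of_le_ne_top ?_ (FracMA.lintegral_kIncRearrangement_le hk hs0 hv hP2 hlevel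
      (FracMA.norm_rpow_mem_Kernels hk hs0))
    have hW : ∀ x : FracMA.E (k + m), 0 ≤ 1 / ‖x‖ ^ p := fun x => by positivity
    simp only [← hp, Real.coe_toNNReal _ (hW _), ← ENNReal.ofReal_mul (hP2 _)]
    rw [← ofReal_integral_eq_lintegral_ofReal hint (ae_of_all _ fun x =>
      mul_nonneg (hP2 x) (hW x))]
    exact ENNReal.ofReal_ne_top
  have hof : ∀ x : FracMA.E (k + m), ENNReal.ofReal
      ((FracMA.kIncRearrangement k m (FracMA.tilde u x₀) x).toReal * (1 / ‖x‖ ^ p)) =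
      FracMA.kIncRearrangement k m (FracMA.tilde u x₀) x * ENNReal.ofReal (1 / ‖x‖ ^ p) :=
    fun x => by rw [ENNReal.ofReal_mul ENNReal.toReal_nonneg, ENNReal.ofReal_toReal (hne x)]
  have hmeas : AEStronglyMeasurable (fun x : FracMA.E (k + m) =>
      (FracMA.kIncRearrangement k m (FracMA.tilde u x₀) x).toReal * (1 / ‖x‖ ^ p)) volume :=
    ((FracMA.measurable_kIncRearrangement hv).ennreal_toReal.mul
      (by fun_prop)).aestronglyMeasurable
  have hnn : ∀ x : FracMA.E (k + m), 0 ≤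
      (FracMA.kIncRearrangement k m (FracMA.tilde u x₀) x).toReal * (1 / ‖x‖ ^ p) :=
    fun x => mul_nonneg ENNReal.toReal_nonneg (by positivity)
  have hw : Integrable fun x : FracMA.E (k + m) =>
      (FracMA.kIncRearrangement k m (FracMA.tilde u x₀) x).toReal * (1 / ‖x‖ ^ p) := by
    rw [← lintegral_ofReal_ne_top_iff_integrable hmeas (ae_of_all _ hnn)]
    simpa only [hof] using hIfin
  refine ⟨_, FracMA.hasFracLaplacianAt_of_integrable (le_add_right hk) ?_ hw, ?_⟩
  · rw [FracMA.kIncRearrangement_zero hk hc FracMA.tilde_zero, ENNReal.toReal_zero]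
  · rw [FracMA.Fop, FracMA.iInf_extIntegral hk hs0 hv hP2 hlevel,
      integral_eq_lintegral_of_nonneg_ae (ae_of_all _ hnn) hmeas]
    simp only [hof]
    rw [← hp, ← hI, EReal.coe_mul]
    congr 1
    exact (EReal.coe_ennreal_toReal hIfin).symm
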